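/- Let $p=p_1\cdots p_N$ be a pattern, i.e. a finite word over a set of variables. A word $w$ over an alphabet encounters $p$ in the abelian sense if it contains a factor $u_1\cdots u_N$ with all $u_i$ nonempty and with $u_i$ a rearrangement of the letters of $u_j$ whenever $p_i=p_j$; otherwise $w$ avoids $p$ in the abelian sense. Suppose that $p$ uses $r$ distinct variables, the $j$-th one occurring $k_j\ge 1$ times, numbered so that $1=k_1=\cdots=k_s<k_{s+1}\le\cdots\le k_r$ (where $0\le s\le r$). For integers $m\ge 4$ and $k\ge 2$ the series $$S_{m,k}=\sum_{\ell=1}^{\infty}\frac{1}{m^{k\ell}}\sum_{i_1+\cdots+i_m=\ell}\binom{\ell}{i_1,\ldots,i_m}^{k}$$ (the inner sum being over nonnegative integers $i_1,\dots,i_m$) converges. Moreover, if $m\ge 4$ and $$n<(1+o(1))\left\{(s+1)!\prod_{j=s+1}^{r}S_{m,k_j}^{-1}\right\}^{\frac{1}{s+1}},$$ then there is a word of length $n$ over an alphabet of $m$ letters that avoids $p$ in the abelian sense. Here $o(1)$ stands for some real sequence $\varepsilon_n$ with $\varepsilon_n\to 0$ as $n\to\infty$, which depends neither on $m$ nor on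 $p$. -/

import Mathlib

open Filter Topology

/-- The word `w` encounters the pattern `p = p₁ ⋯ p_N` in the abelian sense: `w` has a factor
`u₁ ⋯ u_N` with all `uᵢ` nonempty and `uᵢ` a rearrangement of `uⱼ` whenever `pᵢ = pⱼ`. -/
def EncountersAbelian {V A : Type*} (p : List V) (w : List A) : Prop :=
  ∃ u : Fin p.length → List A,
    (∀ i, u i ≠ []) ∧
    (∀ i j, p.get i = p.get j → (u i).Perm (u j)) ∧
    (List.ofFn u).flatten <:+: w

/-- The word `w` avoids the pattern `p` in the abelian sense. -/
def AvoidsAbelian {V A : Type*} (p : List V) (w : List A) : Prop :=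
  ¬ EncountersAbelian p w

/-- `m^{-kℓ} ∑_{i₁ + ⋯ + i_m = ℓ} (ℓ choose i₁, …, i_m)^k`. -/
noncomputable def multinomialTerm (m k ℓ : ℕ) : ℝ :=
  1 / (m : ℝ) ^ (k * ℓ) *
    ∑ i ∈ Finset.piAntidiag (Finset.univ : Finset (Fin m)) ℓ,
      (Nat.multinomial Finset.univ i : ℝ) ^ k

/-- The sum of `multinomialTerm m k ℓ` over all `ℓ ≥ 1`. -/
noncomputable def multinomialSeries (m k : ℕ) : ℝ :=
  ∑' ℓ : ℕ, multinomialTerm m k (ℓ + 1)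

/-- The number `s` of variables that occur exactly once in the pattern `p`. -/
def numSingle {V : Type*} [DecidableEq V] (p : List V) : ℕ :=
  (p.toFinset.filter fun x => p.count x = 1).card

/-- `{(s+1)! ∏ (multinomialSeries m k_x)⁻¹}^{1/(s+1)}`, the product running over the variables `x`
that occur at least twice in `p`, where `k_x` is the number of occurrences of `x`. -/
noncomputable def abelianBound {V : Type*} [DecidableEq V] (m : ℕ) (p : List V) : ℝ :=
  (((numSingle p + 1).factorial : ℝ) *
    ∏ x ∈ p.toFinset.filter (fun x => 1 < p.count x), (multinomialSeries m (p.count x))⁻¹) ^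
      (1 / ((numSingle p : ℝ) + 1))

/-! This is a first moment argument over the `m ^ n` words of length `n`. The probability that `k`
random words of length `ℓ` are rearrangements of each other is at most `multinomialTerm m k ℓ`.
Hence an occurrence with prescribed start and block lengths has probability at most the product of
these terms over the variables (`card_wordsWithOccurrence_le`).

A variable occurring once contributes the factor 1, and summing over the lengths of a repeated
variable gives at most `multinomialSeries`. There remain the start and the lengths of the `s` single
variables: at most `n.choose (s + 1)` choices, hence at most `n ^ (s + 1) / (s + 1)!`. Below the
bound the expected number of occurrences is less than 1, so some word avoids the pattern. This is
exact for `n ≥ 2`. Patterns without repeated variables are treated apart.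

The series converges because a multinomial probability is `O(ℓ ^ (-3/2))` when `m ≥ 4`. -/

/-! ### Words with prescribed letter counts -/

/-- The words of length `n` over `m` letters. -/
def wordsOfLength (m n : ℕ) : Finset (List (Fin m)) :=
  Finset.univ.map ⟨fun f : Fin n → Fin m => List.ofFn f, List.ofFn_injective⟩

theorem mem_wordsOfLength {m n : ℕ} {w : List (Fin m)} :
    w ∈ wordsOfLength m n ↔ w.length = n := by
  simp only [wordsOfLength, Finset.mem_map, Finset.mem_univ, true_and, Function.Embedding.coeFn_mk]
  constructor
  · rintro ⟨f, rfl⟩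
    simp
  · rintro rfl
    exact ⟨w.get, List.ofFn_get w⟩

theorem card_wordsOfLength (m n : ℕ) : (wordsOfLength m n).card = m ^ n := by
  simp [wordsOfLength]

theorem sum_count_eq_length {m : ℕ} (w : List (Fin m)) : ∑ a, w.count a = w.length := by
  simpa using Multiset.sum_count_eq_card (s := Finset.univ) (m := (w : Multiset (Fin m)))
    (fun a _ => Finset.mem_univ a)

/-- The words in which each letter `a` occurs `v a` times. -/
def wordsOfCounts {m : ℕ} (v : Fin m → ℕ) : Finset (List (Fin m)) :=
  (wordsOfLength m (∑ a, v a)).filter fun w => ∀ a, w.count a = v a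

theorem mem_wordsOfCounts {m : ℕ} {v : Fin m → ℕ} {w : List (Fin m)} :
    w ∈ wordsOfCounts v ↔ ∀ a, w.count a = v a := by
  simp only [wordsOfCounts, Finset.mem_filter, mem_wordsOfLength, and_iff_right_iff_imp]
  intro h
  simp [← sum_count_eq_length, h]

/-- Induction on the length, removing the first letter `a`: this lowers `v a` by one and divides the
product of factorials by `v a`, and the `v a` sum to the length. -/
theorem prod_factorial_mul_card_wordsOfCounts_le {m : ℕ} (n : ℕ) (v : Fin m → ℕ)
    (hv : ∑ a, v a = n) : (∏ a, (v a).factorial) * (wordsOfCounts v).card ≤ n.factorial := by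
  induction n generalizing v with
  | zero =>
    have h0 : ∀ a, v a = 0 := by simpa using hv
    have : wordsOfCounts v ⊆ {[]} := by
      intro w hw
      have := sum_count_eq_length w
      simp only [mem_wordsOfCounts.1 hw, hv] at this
      simpa using this.symm
    simpa [h0] using Finset.card_le_card this
  | succ n ih =>
    have hsub : wordsOfCounts v ⊆ (Finset.univ.filter fun a => v a ≠ 0).biUnion
        fun a => (wordsOfCounts (Function.update v a (v a - 1))).image (List.cons a) := by
      intro w hw
      rw [mem_wordsOfCounts] at hw
      cases w with
      | nil =>
        simp only [List.count_nil] at hw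
        simp [← hw] at hv
      | cons b t =>
        simp only [Finset.mem_biUnion, Finset.mem_filter, Finset.mem_univ, true_and,
          Finset.mem_image, mem_wordsOfCounts]
        refine ⟨b, ?_, t, fun a => ?_, rfl⟩
        · rw [← hw b]; simp
        · rw [← hw b]
          by_cases h : a = b
          · subst h; simp
          · rw [Function.update_of_ne h, ← hw a, List.count_cons_of_ne (Ne.symm h)]
    calc (∏ a, (v a).factorial) * (wordsOfCounts v).card
        ≤ (∏ a, (v a).factorial) * ∑ a ∈ Finset.univ.filter fun a => v a ≠ 0,
            (wordsOfCounts (Function.update v a (v a - 1))).card :=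
          Nat.mul_le_mul_left _ ((Finset.card_le_card hsub).trans (Finset.card_biUnion_le.trans
            (Finset.sum_le_sum fun a _ => Finset.card_image_le)))
      _ = ∑ a ∈ Finset.univ.filter fun a => v a ≠ 0, (∏ a, (v a).factorial) *
            (wordsOfCounts (Function.update v a (v a - 1))).card := Finset.mul_sum _ _ _
      _ ≤ ∑ a ∈ Finset.univ.filter fun a => v a ≠ 0, v a * n.factorial := by
          refine Finset.sum_le_sum fun a ha => ?_
          have ha0 : v a ≠ 0 := by simpa using ha
          have hsum : ∑ b, Function.update v a (v a - 1) b = n := by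
            rw [Finset.sum_update_of_mem (Finset.mem_univ a)]
            have := Finset.add_sum_erase Finset.univ v (Finset.mem_univ a)
            rw [← Finset.erase_eq]
            omega
          have hprod : ∏ b, (v b).factorial
              = v a * ∏ b, (Function.update v a (v a - 1) b).factorial := by
            rw [← Finset.mul_prod_erase _ _ (Finset.mem_univ a),
              ← Finset.mul_prod_erase Finset.univ
                (fun b => (Function.update v a (v a - 1) b).factorial) (Finset.mem_univ a),
              Function.update_self, ← mul_assoc, Nat.mul_factorial_pred ha0]
            congr 1
            refine Finset.prod_congr rfl fun b hb => ?_
            rw [Function.update_of_ne (Finset.ne_of_mem_erase hb)]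
          rw [hprod, mul_assoc]
          exact Nat.mul_le_mul_left _ (ih _ hsum)
      _ ≤ ∑ a, v a * n.factorial :=
          Finset.sum_le_sum_of_subset (Finset.filter_subset _ _)
      _ = (n + 1).factorial := by rw [← Finset.sum_mul, hv, Nat.factorial_succ]

theorem card_wordsOfCounts_le {m : ℕ} (v : Fin m → ℕ) :
    (wordsOfCounts v).card ≤ Nat.multinomial Finset.univ v := by
  have h := prod_factorial_mul_card_wordsOfCounts_le _ v rfl
  rw [← Nat.multinomial_spec] at h
  exact Nat.le_of_mul_le_mul_left h (Finset.prod_pos fun a _ => Nat.factorial_pos _)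

/-! ### Counting occurrences of a pattern -/

/-- The tuples of words indexed by the positions of a pattern `q`, in which words at positions
carrying the same variable `x` are rearrangements of each other, of length `ℓ x`. -/
def abelianTuples {N : ℕ} {X : Type*} [Fintype X] [DecidableEq X] (m : ℕ) (q : Fin N → X)
    (ℓ : X → ℕ) : Finset (Fin N → List (Fin m)) :=
  (Fintype.piFinset fun x => Finset.piAntidiag (Finset.univ : Finset (Fin m)) (ℓ x)).biUnion
    fun v => Fintype.piFinset fun i => wordsOfCounts (v (q i))

/-- Once the letter counts of every variable are fixed, the words at the different positions are
chosen independently. -/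
theorem card_abelianTuples_le {N : ℕ} {X : Type*} [Fintype X] [DecidableEq X] (m : ℕ)
    (q : Fin N → X) (ℓ : X → ℕ) :
    (abelianTuples m q ℓ).card ≤ ∏ x, ∑ v ∈ Finset.piAntidiag (Finset.univ : Finset (Fin m)) (ℓ x),
      Nat.multinomial Finset.univ v ^ (Finset.univ.filter fun i => q i = x).card := by
  rw [Finset.prod_univ_sum]
  refine Finset.card_biUnion_le.trans (Finset.sum_le_sum fun v _ => ?_)
  rw [Fintype.card_piFinset]
  calc ∏ i, (wordsOfCounts (v (q i))).card
      ≤ ∏ i, Nat.multinomial Finset.univ (v (q i)) :=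
        Finset.prod_le_prod' fun i _ => card_wordsOfCounts_le _
    _ = ∏ x, Nat.multinomial Finset.univ (v x) ^ (Finset.univ.filter fun i => q i = x).card := by
        rw [← Finset.prod_fiberwise' Finset.univ q fun x => Nat.multinomial Finset.univ (v x)]
        simp

theorem mem_abelianTuples {N m : ℕ} {X : Type*} [Fintype X] [DecidableEq X] {q : Fin N → X}
    (hq : Function.Surjective q) {ℓ : X → ℕ} {u : Fin N → List (Fin m)}
    (hperm : ∀ i j, q i = q j → (u i).Perm (u j)) (hlen : ∀ i, (u i).length = ℓ (q i)) :
    u ∈ abelianTuples m q ℓ := by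
  choose g hg using hq
  simp only [abelianTuples, Finset.mem_biUnion, Fintype.mem_piFinset, Finset.mem_piAntidiag,
    mem_wordsOfCounts]
  refine ⟨fun x a => (u (g x)).count a, fun x => ⟨?_, by simp⟩, fun i a => ?_⟩
  · rw [sum_count_eq_length, hlen, hg]
  · exact (hperm i _ (hg _).symm).count_eq a

/-- The words of length `n` with a factor in `abelianTuples m q ℓ` starting at position `a`. -/
def wordsWithOccurrence {N : ℕ} {X : Type*} [Fintype X] [DecidableEq X] (m n : ℕ) (q : Fin N → X)
    (a : ℕ) (ℓ : X → ℕ) : Finset (List (Fin m)) :=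
  (wordsOfLength m a ×ˢ abelianTuples m q ℓ ×ˢ wordsOfLength m (n - a - ∑ i, ℓ (q i))).image
    fun t => t.1 ++ (List.ofFn t.2.1).flatten ++ t.2.2

/-- Prefix and suffix are free and supply `m ^ (n - ∑ i, ℓ (q i))`; the missing power of `m` is the
normalisation in the terms. -/
theorem card_wordsWithOccurrence_le {N : ℕ} {X : Type*} [Fintype X] [DecidableEq X] {m n : ℕ}
    (hm : 0 < m) (q : Fin N → X) (a : ℕ) (ℓ : X → ℕ) (h : a + ∑ i, ℓ (q i) ≤ n) :
    ((wordsWithOccurrence m n q a ℓ).card : ℝ) ≤ (m : ℝ) ^ n *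
      ∏ x, multinomialTerm m (Finset.univ.filter fun i => q i = x).card (ℓ x) := by
  have hm' : (m : ℝ) ≠ 0 := by positivity
  have hsum : ∑ i, ℓ (q i) = ∑ x, (Finset.univ.filter fun i => q i = x).card * ℓ x := by
    rw [← Finset.sum_fiberwise' Finset.univ q]
    simp
  have hcard : ((wordsWithOccurrence m n q a ℓ).card : ℝ) ≤ (m : ℝ) ^ a *
      ((∏ x, ∑ v ∈ Finset.piAntidiag (Finset.univ : Finset (Fin m)) (ℓ x),
      (Nat.multinomial Finset.univ v : ℝ) ^ (Finset.univ.filter fun i => q i = x).card) *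
        (m : ℝ) ^ (n - a - ∑ i, ℓ (q i))) := by
    have himage : (wordsWithOccurrence m n q a ℓ).card ≤ _ := Finset.card_image_le
    rw [Finset.card_product, Finset.card_product, card_wordsOfLength, card_wordsOfLength] at himage
    exact_mod_cast himage.trans
      (Nat.mul_le_mul_left _ (Nat.mul_le_mul_right _ (card_abelianTuples_le m q ℓ)))
  refine hcard.trans (le_of_eq ?_)
  simp only [multinomialTerm, Finset.prod_mul_distrib, Finset.prod_div_distrib,
    Finset.prod_const_one, Finset.prod_pow_eq_pow_sum, ← hsum]
  have hn : n = a + (n - a - ∑ i, ℓ (q i)) + ∑ i, ℓ (q i) := by omega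
  have hpow : (m : ℝ) ^ n = m ^ a * m ^ (n - a - ∑ i, ℓ (q i)) * m ^ (∑ i, ℓ (q i)) := by
    rw [← pow_add, ← pow_add, ← hn]
  rw [hpow]
  field_simp

/-- If every word of length `n` contains a block of words that follows the pattern `q`, then the
expected number of such blocks, over all starting positions and lengths, is at least `1`. -/
theorem one_le_sum_of_forall_encounters {N : ℕ} {X : Type*} [Fintype X] [DecidableEq X] {m n : ℕ}
    (hm : 0 < m) (q : Fin N → X) (hq : Function.Surjective q)
    (h : ∀ w : List (Fin m), w.length = n → ∃ u : Fin N → List (Fin m), (∀ i, u i ≠ []) ∧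
      (∀ i j, q i = q j → (u i).Perm (u j)) ∧ (List.ofFn u).flatten <:+: w) :
    1 ≤ ∑ t : Fin (n + 1) × (X → Fin n), if (t.1 : ℕ) + ∑ i, ((t.2 (q i) : ℕ) + 1) ≤ n then
      ∏ x, multinomialTerm m (Finset.univ.filter fun i => q i = x).card (t.2 x + 1) else 0 := by
  have hsub : wordsOfLength m n ⊆ (Finset.univ.filter fun t : Fin (n + 1) × (X → Fin n) =>
      (t.1 : ℕ) + ∑ i, ((t.2 (q i) : ℕ) + 1) ≤ n).biUnion
        fun t => wordsWithOccurrence m n q t.1 fun x => t.2 x + 1 := by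
    intro w hw
    rw [mem_wordsOfLength] at hw
    obtain ⟨u, hne, hperm, pre, suf, rfl⟩ := h w hw
    simp only [List.length_append, List.length_flatten, List.map_ofFn, List.sum_ofFn,
      Function.comp_apply] at hw
    have hle : ∀ i, (u i).length ≤ n := fun i =>
      (Finset.single_le_sum (f := fun i => (u i).length) (fun _ _ => Nat.zero_le _)
        (Finset.mem_univ i)).trans (by omega)
    have hpos : ∀ i, 0 < (u i).length := fun i => List.length_pos_of_ne_nil (hne i)
    choose g hg using hq
    have hlen : ∀ i, (u (g (q i))).length - 1 + 1 = (u i).length := fun i => by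
      rw [Nat.sub_add_cancel (hpos _), (hperm _ _ (hg (q i))).length_eq]
    simp only [Finset.mem_biUnion, Finset.mem_filter, Finset.mem_univ, true_and]
    -- Block lengths lie between 1 and `n`, so each is stored in `Fin n` after subtracting 1.
    refine ⟨⟨⟨pre.length, by omega⟩, fun x => ⟨(u (g x)).length - 1, ?_⟩⟩, ?_, ?_⟩
    · have := hpos (g x); have := hle (g x); omega
    · simp only [hlen]; omega
    · simp only [wordsWithOccurrence, Finset.mem_image, Finset.mem_product, mem_wordsOfLength,
        hlen]
      refine ⟨⟨pre, u, suf⟩, ⟨rfl, ?_, by dsimp only; omega⟩, rfl⟩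
      exact mem_abelianTuples (fun x => ⟨g x, hg x⟩) hperm fun i => (hlen i).symm
  have hm' : (0 : ℝ) < (m : ℝ) ^ n := by positivity
  have hcard : (m : ℝ) ^ n ≤ ∑ t ∈ Finset.univ.filter fun t : Fin (n + 1) × (X → Fin n) =>
      (t.1 : ℕ) + ∑ i, ((t.2 (q i) : ℕ) + 1) ≤ n,
      ((wordsWithOccurrence m n q t.1 fun x => t.2 x + 1).card : ℝ) := by
    have := (Finset.card_le_card hsub).trans Finset.card_biUnion_le
    rw [card_wordsOfLength] at this
    exact_mod_cast this
  rw [← Finset.sum_filter]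
  refine le_of_mul_le_mul_left ?_ hm'
  rw [mul_one, Finset.mul_sum]
  refine hcard.trans (Finset.sum_le_sum fun t ht => ?_)
  exact card_wordsWithOccurrence_le hm q t.1 (fun x => t.2 x + 1) (Finset.mem_filter.1 ht).2

/-! ### Decay of multinomial probabilities -/

/-- For fixed `a` the quotient `a ^ i / i!` is largest at `i = a`. -/
theorem factorial_mul_pow_le_factorial_mul_pow (a i : ℕ) :
    a.factorial * a ^ i ≤ i.factorial * a ^ a := by
  rcases le_total a i with h | h
  · calc a.factorial * a ^ i = a.factorial * a ^ (i - a) * a ^ a := by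
          rw [mul_assoc, ← pow_add, Nat.sub_add_cancel h]
      _ ≤ _ := Nat.mul_le_mul_right _ (Nat.factorial_mul_pow_sub_le_factorial h)
  · calc a.factorial * a ^ i = i.factorial * a.descFactorial (a - i) * a ^ i := by
          rw [← Nat.factorial_mul_descFactorial (Nat.sub_le a i), Nat.sub_sub_self h]
      _ ≤ i.factorial * a ^ (a - i) * a ^ i := by
          gcongr
          exact Nat.descFactorial_le_pow _ _
      _ = _ := by rw [mul_assoc, ← pow_add, Nat.sub_add_cancel h]

/-- Stirling is used only at `a`. The bound is exponential in `i`, so a product of such bounds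
depends on the exponents only through their sum. -/
theorem sqrt_mul_exp_mul_pow_le_factorial {a : ℕ} (ha : 0 < a) (i : ℕ) :
    √a * Real.exp (-a) * (a : ℝ) ^ i ≤ i.factorial := by
  have ha' : (0 : ℝ) < a := by exact_mod_cast ha
  have h1 : (a.factorial : ℝ) * a ^ i ≤ i.factorial * a ^ a := by
    exact_mod_cast factorial_mul_pow_le_factorial_mul_pow a i
  have h2 : √a * (a / Real.exp 1) ^ a ≤ a.factorial := by
    refine le_trans ?_ (Stirling.le_factorial_stirling a)
    gcongr
    nlinarith [Real.pi_gt_three]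
  have h3 : (a / Real.exp 1) ^ a = (a : ℝ) ^ a * Real.exp (-a) := by
    rw [div_pow, ← Real.exp_nat_mul, mul_one, Real.exp_neg, div_eq_mul_inv]
  rw [h3] at h2
  refine le_of_mul_le_mul_right ?_ (pow_pos ha' a)
  calc √a * Real.exp (-a) * (a : ℝ) ^ i * a ^ a
      = √a * (a ^ a * Real.exp (-a)) * a ^ i := by ring
    _ ≤ a.factorial * a ^ i := by gcongr
    _ ≤ _ := h1

theorem factorial_le_stirling {n : ℕ} (hn : 0 < n) :
    (n.factorial : ℝ) ≤ Real.exp 1 * √n * (n / Real.exp 1) ^ n := by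
  obtain ⟨k, rfl⟩ := Nat.exists_eq_succ_of_ne_zero hn.ne'
  have h : Stirling.stirlingSeq (k + 1) ≤ Stirling.stirlingSeq 1 :=
    Stirling.stirlingSeq'_antitone (Nat.zero_le k)
  rw [Stirling.stirlingSeq_one, Stirling.stirlingSeq, div_le_iff₀ (by positivity)] at h
  refine h.trans (le_of_eq ?_)
  rw [Real.sqrt_mul (by norm_num)]
  field_simp

/-- All factorials are compared with that of the mean `a = ℓ / m`, so the bound does not depend on
`v`. The factor `4 * m ^ 2` comes from `ℓ ≤ 2 * m * a`. -/
theorem multinomial_div_pow_le {m : ℕ} (hm : 4 ≤ m) {ℓ : ℕ} (hℓ : m ≤ ℓ) {v : Fin m → ℕ}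
    (hv : ∑ j, v j = ℓ) :
    (Nat.multinomial Finset.univ v : ℝ) / (m : ℝ) ^ ℓ ≤
      Real.exp (1 + 2 * m) * (4 * m ^ 2) * (√ℓ / ℓ ^ 2) := by
  set a := ℓ / m with ha_def
  have ha : 0 < a := Nat.div_pos hℓ (by omega)
  have hm0 : (0 : ℝ) < m := by exact_mod_cast (by omega : 0 < m)
  have ha1 : (1 : ℝ) ≤ a := by exact_mod_cast ha
  have ha0 : (0 : ℝ) < a := by linarith
  have hℓ0 : (0 : ℝ) < ℓ := by exact_mod_cast (by omega : 0 < ℓ)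
  have hlow : (m : ℝ) * a ≤ ℓ := by exact_mod_cast Nat.mul_div_le ℓ m
  have hupp : (ℓ : ℝ) ≤ m * a + m := by
    have := Nat.lt_mul_div_succ ℓ (by omega : 0 < m)
    have h' : ℓ ≤ m * a + m := by rw [← ha_def] at this; nlinarith
    exact_mod_cast h'
  have hupp2 : (ℓ : ℝ) ≤ 2 * m * a := by nlinarith
  have hspec : (∏ j, ((v j).factorial : ℝ)) * (Nat.multinomial Finset.univ v : ℝ)
      = ℓ.factorial := by
    rw [← hv]
    exact_mod_cast Nat.multinomial_spec Finset.univ v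
  have hprod : √a ^ m * Real.exp (-(m * a)) * (a : ℝ) ^ ℓ ≤ ∏ j, ((v j).factorial : ℝ) := by
    calc √a ^ m * Real.exp (-(m * a)) * (a : ℝ) ^ ℓ
        = ∏ j, (√a * Real.exp (-a) * (a : ℝ) ^ v j) := by
          rw [Finset.prod_mul_distrib, Finset.prod_pow_eq_pow_sum, hv, Finset.prod_const,
            Finset.card_univ, Fintype.card_fin, mul_pow, ← Real.exp_nat_mul, mul_neg]
      _ ≤ _ := Finset.prod_le_prod (fun j _ => by positivity)
          fun j _ => sqrt_mul_exp_mul_pow_le_factorial ha (v j)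
  -- Here `m ≥ 4` enters: it gives the decay `√ℓ / ℓ ^ 2`, which is summable.
  have hsq : (a : ℝ) ^ 2 ≤ √a ^ m := by
    calc (a : ℝ) ^ 2 = √a ^ 4 := by
          rw [show (4 : ℕ) = 2 * 2 by norm_num, pow_mul, Real.sq_sqrt ha0.le]
      _ ≤ √a ^ m := pow_le_pow_right₀ (Real.one_le_sqrt.2 ha1) hm
  -- Cost of rounding the mean down: `(ℓ / (m * a)) ^ ℓ ≤ exp (ℓ / a) ≤ exp (2 * m)`.
  have hratio : (ℓ : ℝ) ^ ℓ ≤ Real.exp (2 * m) * (m * a) ^ ℓ := by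
    have h1 : (ℓ : ℝ) ≤ Real.exp (1 / a) * (m * a) := by
      calc (ℓ : ℝ) ≤ (1 / a + 1) * (m * a) := by field_simp; linarith
        _ ≤ _ := by gcongr; exact Real.add_one_le_exp _
    calc (ℓ : ℝ) ^ ℓ ≤ (Real.exp (1 / a) * (m * a)) ^ ℓ := by gcongr
      _ = Real.exp (ℓ / a) * (m * a) ^ ℓ := by
          rw [mul_pow, ← Real.exp_nat_mul, mul_one_div]
      _ ≤ _ := by
          gcongr
          rw [div_le_iff₀ ha0]
          linarith
  have hfac : (ℓ.factorial : ℝ) ≤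
      Real.exp (1 + 2 * m) * √ℓ * (m ^ ℓ * (Real.exp (-(m * a)) * a ^ ℓ)) := by
    calc (ℓ.factorial : ℝ) ≤ Real.exp 1 * √ℓ * (ℓ / Real.exp 1) ^ ℓ :=
          factorial_le_stirling (by omega)
      _ = Real.exp 1 * √ℓ * (ℓ ^ ℓ * Real.exp (-ℓ)) := by
          rw [div_pow, ← Real.exp_nat_mul, mul_one, Real.exp_neg, div_eq_mul_inv]
      _ ≤ Real.exp 1 * √ℓ * (Real.exp (2 * m) * (m * a) ^ ℓ * Real.exp (-(m * a))) := by
          gcongr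
      _ = _ := by rw [Real.exp_add, mul_pow]; ring
  have hmul : (a : ℝ) ^ 2 * (Nat.multinomial Finset.univ v : ℝ) ≤
      Real.exp (1 + 2 * m) * √ℓ * m ^ ℓ := by
    have hpos : (0 : ℝ) < Real.exp (-(m * a)) * a ^ ℓ := by positivity
    refine le_of_mul_le_mul_right ?_ hpos
    calc (a : ℝ) ^ 2 * (Nat.multinomial Finset.univ v : ℝ) * (Real.exp (-(m * a)) * a ^ ℓ)
        ≤ √a ^ m * (Nat.multinomial Finset.univ v : ℝ) * (Real.exp (-(m * a)) * a ^ ℓ) := by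
          gcongr
      _ = (√a ^ m * Real.exp (-(m * a)) * (a : ℝ) ^ ℓ) * Nat.multinomial Finset.univ v := by ring
      _ ≤ (∏ j, ((v j).factorial : ℝ)) * Nat.multinomial Finset.univ v := by gcongr
      _ ≤ _ := by rw [hspec]; refine hfac.trans (le_of_eq ?_); ring
  rw [div_le_iff₀ (by positivity), mul_div_assoc', div_mul_eq_mul_div, le_div_iff₀ (by positivity)]
  calc (Nat.multinomial Finset.univ v : ℝ) * ℓ ^ 2
      ≤ Nat.multinomial Finset.univ v * (2 * m * a) ^ 2 := by gcongr
    _ = 4 * (m : ℝ) ^ 2 * ((a : ℝ) ^ 2 * Nat.multinomial Finset.univ v) := by ring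
    _ ≤ 4 * (m : ℝ) ^ 2 * (Real.exp (1 + 2 * m) * √ℓ * (m : ℝ) ^ ℓ) := by gcongr
    _ = _ := by ring

/-! ### Convergence of the series -/

theorem multinomialTerm_eq_sum (m k ℓ : ℕ) :
    multinomialTerm m k ℓ = ∑ v ∈ Finset.piAntidiag (Finset.univ : Finset (Fin m)) ℓ,
      ((Nat.multinomial Finset.univ v : ℝ) / (m : ℝ) ^ ℓ) ^ k := by
  rw [multinomialTerm, Finset.mul_sum]
  refine Finset.sum_congr rfl fun v _ => ?_
  rw [div_pow, ← pow_mul, mul_comm k ℓ, one_div_mul_eq_div]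

theorem multinomialTerm_nonneg (m k ℓ : ℕ) : 0 ≤ multinomialTerm m k ℓ := by
  rw [multinomialTerm_eq_sum]
  exact Finset.sum_nonneg fun v _ => by positivity

/-- The multinomial theorem with all variables equal to 1: multinomial probabilities sum to 1. -/
theorem multinomialTerm_one {m : ℕ} (hm : 0 < m) (ℓ : ℕ) : multinomialTerm m 1 ℓ = 1 := by
  have h := Finset.sum_pow_eq_sum_piAntidiag (Finset.univ : Finset (Fin m)) (fun _ => (1 : ℝ)) ℓ
  simp only [Finset.sum_const, Finset.card_univ, Fintype.card_fin, nsmul_eq_mul, mul_one, one_pow,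
    Finset.prod_const_one] at h
  simp only [multinomialTerm, one_mul, pow_one, ← h]
  have : (m : ℝ) ^ ℓ ≠ 0 := by positivity
  field_simp

/-- For a probability distribution, the sum of `k`-th powers with `k ≥ 2` is at most the largest
probability. -/
theorem multinomialTerm_le {m k ℓ : ℕ} (hm : 0 < m) (hk : 2 ≤ k) {B : ℝ}
    (hB : ∀ v : Fin m → ℕ, ∑ j, v j = ℓ →
      (Nat.multinomial Finset.univ v : ℝ) / (m : ℝ) ^ ℓ ≤ B) :
    multinomialTerm m k ℓ ≤ B := by
  have hone := multinomialTerm_one hm ℓ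
  rw [multinomialTerm_eq_sum] at hone ⊢
  simp only [pow_one] at hone
  calc ∑ v ∈ Finset.piAntidiag (Finset.univ : Finset (Fin m)) ℓ,
        ((Nat.multinomial Finset.univ v : ℝ) / (m : ℝ) ^ ℓ) ^ k
      ≤ ∑ v ∈ Finset.piAntidiag (Finset.univ : Finset (Fin m)) ℓ,
        B * ((Nat.multinomial Finset.univ v : ℝ) / (m : ℝ) ^ ℓ) := by
        refine Finset.sum_le_sum fun v hv => ?_
        have h0 : 0 ≤ (Nat.multinomial Finset.univ v : ℝ) / (m : ℝ) ^ ℓ := by positivity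
        have h1 : (Nat.multinomial Finset.univ v : ℝ) / (m : ℝ) ^ ℓ ≤ 1 := by
          rw [← hone]
          exact Finset.single_le_sum (f := fun v : Fin m → ℕ =>
            (Nat.multinomial Finset.univ v : ℝ) / (m : ℝ) ^ ℓ) (fun _ _ => by positivity) hv
        refine (pow_le_pow_of_le_one h0 h1 hk).trans ?_
        rw [sq]
        exact mul_le_mul_of_nonneg_right (hB v (Finset.mem_piAntidiag.1 hv).1) h0
    _ = B := by rw [← Finset.mul_sum, hone, mul_one]

theorem summable_multinomialTerm {m k : ℕ} (hm : 4 ≤ m) (hk : 2 ≤ k) :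
    Summable fun ℓ : ℕ => multinomialTerm m k (ℓ + 1) := by
  -- The shift by 1 is traded for a shift by `m`, since the decay estimate needs `m ≤ ℓ`.
  rw [summable_nat_add_iff 1, ← summable_nat_add_iff m]
  have hp : Summable fun ℓ : ℕ => √(ℓ : ℝ) / (ℓ : ℝ) ^ 2 := by
    refine (Real.summable_nat_rpow_inv.2 (by norm_num : (1 : ℝ) < 3 / 2)).congr fun ℓ => ?_
    rcases Nat.eq_zero_or_pos ℓ with rfl | h
    · norm_num
    · have h' : (0 : ℝ) < ℓ := by exact_mod_cast h
      rw [Real.sqrt_eq_rpow, ← Real.rpow_natCast, ← Real.rpow_sub h', ← Real.rpow_neg h'.le]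
      norm_num
  refine Summable.of_nonneg_of_le (fun ℓ => multinomialTerm_nonneg _ _ _) (fun ℓ => ?_)
    (((summable_nat_add_iff m).2 hp).mul_left (Real.exp (1 + 2 * m) * (4 * m ^ 2)))
  exact multinomialTerm_le (by omega) hk fun v hv =>
    multinomial_div_pow_le hm (Nat.le_add_left m ℓ) hv

/-! ### Bounding the expected number of occurrences -/

/-- Stars and bars: the start, the `s` reduced lengths and one slack variable (`some none`) are `s +
2` natural numbers with sum `n - 1 - s`. -/
theorem card_filter_add_sum_lt_le (σ : Type*) [Fintype σ] [DecidableEq σ] (n : ℕ) :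
    (Finset.univ.filter fun t : Fin (n + 1) × (σ → Fin n) =>
      (t.1 : ℕ) + ∑ x, ((t.2 x : ℕ) + 1) + 1 ≤ n).card ≤ n.choose (Fintype.card σ + 1) := by
  set s := Fintype.card σ with hs
  have hsum : ∀ f : σ → Fin n, ∑ x, ((f x : ℕ) + 1) = ∑ x, (f x : ℕ) + s := fun f => by
    simp [Finset.sum_add_distrib, hs]
  simp only [hsum]
  rcases lt_or_ge n (s + 1) with hn | hn
  · rw [Finset.filter_eq_empty_iff.2, Finset.card_empty]
    · exact Nat.zero_le _
    · intro t _
      omega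
  have hcard : (Finset.piAntidiag (Finset.univ : Finset (Option (Option σ))) (n - 1 - s)).card
      = n.choose (s + 1) := by
    rw [← Finset.map_sym_eq_piAntidiag, Finset.card_map, Finset.sym_univ, Finset.card_univ,
      Sym.card_sym_eq_choose, Fintype.card_option, Fintype.card_option, ← hs,
      ← Nat.choose_symm (by omega)]
    congr 1 <;> omega
  rw [← hcard]
  refine Finset.card_le_card_of_injOn (fun t o => match o with
    | none => (t.1 : ℕ)
    | some none => n - 1 - s - t.1 - ∑ x, (t.2 x : ℕ)
    | some (some x) => (t.2 x : ℕ)) ?_ ?_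
  · intro t ht
    have ht' : (t.1 : ℕ) + (∑ x, (t.2 x : ℕ) + s) + 1 ≤ n := by simpa using ht
    simp only [Finset.mem_coe, Finset.mem_piAntidiag, Finset.mem_univ, implies_true, and_true,
      Fintype.sum_option]
    omega
  · intro t _ t' _ h
    refine Prod.ext (Fin.ext (congrFun h none)) (funext fun x => Fin.ext ?_)
    exact congrFun h (some (some x))

/-- An upper bound for the expected number of blocks that follow a pattern in which the variable
`x` occurs `k x` times, if some variable occurs more than once. -/
theorem sum_prod_multinomialTerm_le {X : Type*} [Fintype X] [DecidableEq X] {m : ℕ} (hm : 4 ≤ m)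
    (n : ℕ) (k : X → ℕ) (hk : ∀ x, 0 < k x) (hmulti : ∃ x, k x ≠ 1) :
    (∑ t : Fin (n + 1) × (X → Fin n), if (t.1 : ℕ) + ∑ x, k x * ((t.2 x : ℕ) + 1) ≤ n then
      ∏ x, multinomialTerm m (k x) (t.2 x + 1) else 0) ≤
    (n.choose (Fintype.card {x // k x = 1} + 1) : ℝ) *
      ∏ x : {x // ¬ k x = 1}, multinomialSeries m (k x) := by
  have hprod : ∀ f : X → Fin n, ∏ x, multinomialTerm m (k x) (f x + 1)
      = ∏ x : {x // ¬ k x = 1}, multinomialTerm m (k x) (f x + 1) := fun f => by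
    rw [← Fintype.prod_subtype_mul_prod_subtype (fun x => k x = 1)]
    rw [Finset.prod_eq_one, one_mul]
    intro x _
    rw [x.2, multinomialTerm_one (by omega)]
  -- The final `+ 1` is a letter used by some repeated variable. Without it the count would be `(n +
  -- 1).choose (s + 1)`, which can exceed `n ^ (s + 1) / (s + 1)!`.
  have hlen : ∀ f : X → Fin n, ∑ x : {x // k x = 1}, ((f x : ℕ) + 1) + 1
      ≤ ∑ x, k x * ((f x : ℕ) + 1) := fun f => by
    rw [← Fintype.sum_subtype_add_sum_subtype (fun x => k x = 1)]
    obtain ⟨y, hy⟩ := hmulti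
    refine Nat.add_le_add (Finset.sum_le_sum fun x _ => ?_) ?_
    · rw [x.2, one_mul]
    · refine le_trans ?_ (Finset.single_le_sum
        (f := fun x : {x // ¬ k x = 1} => k x * ((f x : ℕ) + 1))
        (fun _ _ => Nat.zero_le _) (Finset.mem_univ ⟨y, hy⟩))
      exact Nat.mul_pos (hk y) (Nat.succ_pos _)
  -- Forgetting the lengths of the repeated variables in the constraint makes the sum factor.
  calc _ ≤ ∑ t : Fin (n + 1) × (X → Fin n),
        (if (t.1 : ℕ) + ∑ x : {x // k x = 1}, ((t.2 x : ℕ) + 1) + 1 ≤ n then (1 : ℝ) else 0) *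
          ∏ x : {x // ¬ k x = 1}, multinomialTerm m (k x) (t.2 x + 1) := by
        refine Finset.sum_le_sum fun t _ => ?_
        have h0 : 0 ≤ ∏ x : {x // ¬ k x = 1}, multinomialTerm m (k x) (t.2 x + 1) :=
          Finset.prod_nonneg fun x _ => multinomialTerm_nonneg _ _ _
        rw [hprod]
        have := hlen t.2
        split_ifs <;> first | omega | simp [h0]
    _ = (∑ t : Fin (n + 1) × ({x // k x = 1} → Fin n),
          if (t.1 : ℕ) + ∑ x, ((t.2 x : ℕ) + 1) + 1 ≤ n then (1 : ℝ) else 0) *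
        ∑ h : {x // ¬ k x = 1} → Fin n,
          ∏ x : {x // ¬ k x = 1}, multinomialTerm m (k x) (h x + 1) := by
        rw [Fintype.sum_prod_type, Fintype.sum_prod_type, Finset.sum_mul]
        refine Finset.sum_congr rfl fun a _ => ?_
        rw [Finset.sum_mul_sum, ← Fintype.sum_prod_type']
        exact Fintype.sum_equiv (Equiv.piEquivPiSubtypeProd (fun x => k x = 1) fun _ => Fin n)
          _ _ fun f => rfl
    _ ≤ _ := by
        have hS : (∑ h : {x // ¬ k x = 1} → Fin n,
          ∏ x : {x // ¬ k x = 1}, multinomialTerm m (k x) (h x + 1))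
            ≤ ∏ x : {x // ¬ k x = 1}, multinomialSeries m (k x) := by
          have h := Finset.prod_univ_sum (fun _ : {x // ¬ k x = 1} => (Finset.univ : Finset (Fin n)))
            fun x j => multinomialTerm m (k x) ((j : ℕ) + 1)
          rw [Fintype.piFinset_univ] at h
          rw [← h]
          refine Finset.prod_le_prod
            (fun x _ => Finset.sum_nonneg fun j _ => multinomialTerm_nonneg _ _ _) fun x _ => ?_
          have hx : 2 ≤ k x := by have := hk x; have := x.2; omega
          rw [Fin.sum_univ_eq_sum_range fun j => multinomialTerm m (k x) (j + 1)]
          exact (summable_multinomialTerm hm hx).sum_le_tsum _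
            fun j _ => multinomialTerm_nonneg _ _ _
        refine mul_le_mul ?_ hS (Finset.sum_nonneg fun h _ =>
          Finset.prod_nonneg fun x _ => multinomialTerm_nonneg _ _ _) (by positivity)
        rw [Finset.sum_boole]
        exact_mod_cast card_filter_add_sum_lt_le {x // k x = 1} n

/-! ### Application to patterns -/

theorem card_filter_get_eq_count {V : Type*} [DecidableEq V] (p : List V) (x : V) :
    (Finset.univ.filter fun i => p.get i = x).card = p.count x :=
  Fin.card_filter_univ_eq_vector_get_eq_count x ⟨p, rfl⟩

/-- The first moment bound: if every word of length `n` encounters a pattern that has a repeated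
variable, then the expected number of encounters is at least `1`. -/
theorem one_le_of_forall_encountersAbelian {V : Type*} [DecidableEq V] (p : List V) {m n : ℕ}
    (hm : 4 ≤ m) (hp : ∃ x ∈ p, p.count x ≠ 1)
    (h : ∀ w : List (Fin m), w.length = n → EncountersAbelian p w) :
    1 ≤ (n : ℝ) ^ (numSingle p + 1) / (numSingle p + 1).factorial *
      ∏ x ∈ p.toFinset.filter (fun x => 1 < p.count x), multinomialSeries m (p.count x) := by
  -- Restricting to the variables that occur makes the index type finite and `q` surjective.
  let q : Fin p.length → p.toFinset := fun i => ⟨p.get i, by simp⟩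
  have hq : Function.Surjective q := by
    rintro ⟨x, hx⟩
    obtain ⟨i, hi⟩ := List.get_of_mem (List.mem_toFinset.1 hx)
    exact ⟨i, Subtype.ext hi⟩
  have hfib : ∀ x : p.toFinset, (Finset.univ.filter fun i => q i = x).card = p.count (x : V) := by
    intro x
    rw [← card_filter_get_eq_count]
    simp only [q, Subtype.ext_iff]
  have hcount : ∀ x : p.toFinset, 0 < p.count (x : V) := fun x =>
    List.count_pos_iff.2 (List.mem_toFinset.1 x.2)
  have hone := one_le_sum_of_forall_encounters (m := m) (n := n) (by omega) q hq fun w hw => by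
    obtain ⟨u, hne, hperm, hfac⟩ := h w hw
    exact ⟨u, hne, fun i j hij => hperm i j (congrArg Subtype.val hij), hfac⟩
  have hsum : ∀ f : p.toFinset → Fin n, ∑ i, ((f (q i) : ℕ) + 1)
      = ∑ x : p.toFinset, p.count (x : V) * ((f x : ℕ) + 1) := fun f => by
    rw [← Finset.sum_fiberwise' Finset.univ q fun x => (f x : ℕ) + 1]
    refine Finset.sum_congr rfl fun x _ => ?_
    rw [Finset.sum_const, hfib, smul_eq_mul]
  simp only [hsum, hfib] at hone
  have hle := hone.trans (sum_prod_multinomialTerm_le hm n (fun x : p.toFinset => p.count (x : V))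
    hcount (by obtain ⟨x, hx, hx1⟩ := hp; exact ⟨⟨x, List.mem_toFinset.2 hx⟩, hx1⟩))
  have hsingle : Fintype.card {x : p.toFinset // p.count (x : V) = 1} = numSingle p := by
    rw [numSingle, Fintype.card_subtype, ← Finset.card_map (Function.Embedding.subtype _)]
    congr 1
    ext x
    simp [and_comm]
  have hprod : ∏ x : {x : p.toFinset // ¬ p.count (x : V) = 1}, multinomialSeries m (p.count x.1.1)
      = ∏ x ∈ p.toFinset.filter (fun x => 1 < p.count x), multinomialSeries m (p.count x) := by
    rw [← Finset.prod_subtype (Finset.univ.filter fun x : p.toFinset => ¬ p.count (x : V) = 1)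
      (by simp) fun x : p.toFinset => multinomialSeries m (p.count x.1)]
    rw [Finset.prod_filter, Finset.prod_filter, ← Finset.prod_coe_sort p.toFinset]
    refine Finset.prod_congr rfl fun x _ => ?_
    have := hcount x
    exact if_congr (by omega) rfl rfl
  rw [hsingle, hprod] at hle
  refine hle.trans (mul_le_mul_of_nonneg_right (Nat.choose_le_pow_div _ _) ?_)
  exact Finset.prod_nonneg fun x _ => tsum_nonneg fun ℓ => multinomialTerm_nonneg _ _ _

theorem length_le_of_encountersAbelian {V A : Type*} {p : List V} {w : List A}
    (h : EncountersAbelian p w) : p.length ≤ w.length := by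
  obtain ⟨u, hne, -, hfac⟩ := h
  refine le_trans ?_ hfac.length_le
  rw [List.length_flatten, List.map_ofFn, List.sum_ofFn]
  calc p.length = ∑ _i : Fin p.length, 1 := by simp
    _ ≤ _ := Finset.sum_le_sum fun i _ => List.length_pos_of_ne_nil (hne i)

/-- Used for patterns without repeated variables, where the bound then forces `n` below the pattern
length. -/
theorem factorial_succ_le_pow {s n : ℕ} (hn : 2 ≤ n) (hs : s ≤ n) :
    (s + 1).factorial ≤ n ^ (s + 1) := by
  have h : ∀ j, j + 1 ≤ n → (j + 1).factorial ≤ n ^ j := by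
    intro j
    induction j with
    | zero => simp
    | succ j ih =>
      intro hj
      rw [Nat.factorial_succ, pow_succ, mul_comm]
      exact Nat.mul_le_mul (ih (by omega)) hj
  rcases Nat.eq_zero_or_pos s with rfl | hs0
  · simpa using by omega
  obtain ⟨j, rfl⟩ := Nat.exists_eq_succ_of_ne_zero hs0.ne'
  rw [Nat.factorial_succ, pow_succ, pow_succ, mul_comm, mul_assoc]
  exact Nat.mul_le_mul (h j hs) (by nlinarith [hs])

theorem pow_lt_of_lt_abelianBound {V : Type*} [DecidableEq V] {p : List V} {m n : ℕ}
    (h : (n : ℝ) < abelianBound m p) :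
    (n : ℝ) ^ (numSingle p + 1) < ((numSingle p + 1).factorial : ℝ) *
      ∏ x ∈ p.toFinset.filter (fun x => 1 < p.count x), (multinomialSeries m (p.count x))⁻¹ := by
  have h0 : 0 ≤ ∏ x ∈ p.toFinset.filter (fun x => 1 < p.count x),
      (multinomialSeries m (p.count x))⁻¹ :=
    Finset.prod_nonneg fun x _ => inv_nonneg.2 (tsum_nonneg fun ℓ => multinomialTerm_nonneg _ _ _)
  rw [abelianBound, one_div, Real.lt_rpow_inv_iff_of_pos (by positivity) (by positivity)
    (by positivity)] at h
  exact_mod_cast h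

theorem exists_avoidsAbelian_of_lt_abelianBound {V : Type*} [DecidableEq V] (p : List V)
    {m n : ℕ} (hm : 4 ≤ m) (hn : 2 ≤ n) (h : (n : ℝ) < abelianBound m p) :
    ∃ w : List (Fin m), w.length = n ∧ AvoidsAbelian p w := by
  have hlt := pow_lt_of_lt_abelianBound h
  by_cases hp : ∃ x ∈ p, p.count x ≠ 1
  · by_contra hcon
    have hone := one_le_of_forall_encountersAbelian p hm hp fun w hw => by
      by_contra hw'
      exact hcon ⟨w, hw, hw'⟩
    rw [Finset.prod_inv_distrib] at hlt
    set S := ∏ x ∈ p.toFinset.filter (fun x => 1 < p.count x), multinomialSeries m (p.count x)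
    have hS0 : 0 ≤ S :=
      Finset.prod_nonneg fun x _ => tsum_nonneg fun ℓ => multinomialTerm_nonneg _ _ _
    have hS : 0 < S := by
      -- Positivity of `S` comes from the first moment bound itself, which would read `1 ≤ 0` if `S`
      -- vanished.
      refine hS0.lt_of_ne fun h0 => ?_
      rw [← h0, mul_zero] at hone
      linarith
    have hfac : (0 : ℝ) < (numSingle p + 1).factorial := by positivity
    rw [div_mul_eq_mul_div, le_div_iff₀ hfac, one_mul] at hone
    rw [← div_eq_mul_inv, lt_div_iff₀ hS] at hlt
    linarith
  · push Not at hp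
    have hmulti : p.toFinset.filter (fun x => 1 < p.count x) = ∅ :=
      Finset.filter_eq_empty_iff.2 fun x hx => by simp [hp x (List.mem_toFinset.1 hx)]
    have hlen : numSingle p = p.length := by
      rw [numSingle, Finset.filter_true_of_mem fun x hx => hp x (List.mem_toFinset.1 hx)]
      exact List.toFinset_card_of_nodup
        (List.nodup_iff_count_eq_one.2 hp)
    rw [hmulti, Finset.prod_empty, mul_one, hlen] at hlt
    have hlt' : n ^ (p.length + 1) < (p.length + 1).factorial := by exact_mod_cast hlt
    -- Every word of length `n` is too short to encounter `p`, so a constant word will do.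
    refine ⟨List.replicate n ⟨0, by omega⟩, List.length_replicate, fun henc => ?_⟩
    have hle := length_le_of_encountersAbelian henc
    rw [List.length_replicate] at hle
    exact absurd (factorial_succ_le_pow hn hle) (not_le.2 hlt')

theorem mainTheorem5 :
    (∀ m k : ℕ, 4 ≤ m → 2 ≤ k → Summable fun ℓ : ℕ => multinomialTerm m k (ℓ + 1)) ∧
    ∃ ε : ℕ → ℝ, Tendsto ε atTop (𝓝 0) ∧
      ∀ (V : Type*) [DecidableEq V] (p : List V) (m n : ℕ), 4 ≤ m →
        (n : ℝ) < (1 + ε n) * abelianBound m p →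
          ∃ w : List (Fin m), w.length = n ∧ AvoidsAbelian p w := by
  refine ⟨fun m k hm hk => summable_multinomialTerm hm hk,
    -- For `n < 2` a negative `ε n` is forced by the patterns of length `0` and `1`.
    fun n => if n < 2 then -1 else 0, ?_, ?_⟩
  · refine tendsto_const_nhds.congr' ?_
    filter_upwards [eventually_ge_atTop 2] with n hn
    rw [if_neg (by omega)]
  · intro V _ p m n hm h
    beta_reduce at h
    by_cases hn : n < 2
    · rw [if_pos hn, add_neg_cancel, zero_mul] at h
      exact absurd h (not_lt.2 (Nat.cast_nonneg n))
    · rw [if_neg hn, add_zero, one_mul] at h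
      exact exists_avoidsAbelian_of_lt_abelianBound p hm (by omega) h
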